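/- **Setting.** Let $k$ be a local field of characteristic $0$ other than $\mathbb C$ (a locally compact, non-discrete field), with its normalized absolute value $|\cdot|$ (the factor by which multiplication scales Haar measure) and a Haar measure $\nu=dx$ on $k$. Let $m\ge 1$, $d\ge 2$, and let $f\in k[x_1,\dots,x_m]$ be homogeneous of degree $d$. For $c\in k$ put $L_c=\{x\in k^m : f(x)=c\}$, and let $L_c'=\{x\in L_c:\nabla f(x)\ne 0\}$ be its smooth part. The canonical measure $\mu_{f,c}$ on $L_c'$ is the one defined by $|\rho|$, where $\rho=(dx_1\wedge\dots\wedge dx_m)/df$; that is, on $\{x\in L_c : \partial f/\partial x_i(x)\neq 0\}$, where the projection $\pi_i$ omitting $x_i$ is a local analytic isomorphism to $k^{m-1}$, it is $|\partial f/\partial x_i|^{-1}\,|\pi_i^*(dx_1\cdots\widehat{dx_i}\cdots dx_m)|$. It is regarded as a Borel measure on $k^m$ that vanishes off $L_c'$. Let $\|\cdot\|$ be any norm on $k^m$, let $B_R=\{x:\|x\|\le R\}$, and measure gradients by $\|\nabla f(x)\|=\max_i|\partial f/\partial x_i(x)|$. **Proposition.** Suppose that $0$ is the only singular point of $L_0$,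 i.e. $f(x)=0$ and $\nabla f(x)=0$ with $x\in k^m$ imply $x=0$. Then: 1. For every compact $W\subset k\setminus\{0\}$ there is $\delta>0$ with $\|\nabla f(x)\|\ge\delta$ for all $c\in W$ and all $x\in L_c$ with $\|x\|\ge 1$. 2. For every compact $W\subset k\setminus\{0\}$ there is a constant $A$ with $\mu_{f,c}(B_R)\le A R^{m-1}$ for all $c\in W$ and $R\ge 1$. In particular $\mu_{f,c}(B_R)=O(R^{m-1})$ for every $c\ne 0$. 3. For $c=0$, there is a constant $A$ with $\mu_{f,0}(B_R\setminus B_1)\le A R^{m-1}$ for all $R\ge 1$. 4. If $m>d$, then $\mu_{f,0}$, defined on $L_0\setminus\{0\}$, is finite on some neighbourhood of $0$, and it extends to a locally finite Borel measure $\mu'$ on $L_0$ for which there is a constant $A$ with $\mu'(B_R)\le A R^{m-1}$ for all $R\ge 1$. 5. For $m\le d$ the finiteness near $0$ can fail: for $f=X^4+Y^4-Z^4$ (so $m=3$, $d=4$), $0$ is the only singular point of $L_0$, but $\mu_{f,0}(U)=\infty$ for every neighbourhood $U$ of $0$ in $k^3$. -/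

import Mathlib

open MeasureTheory Topology Set
open scoped ENNReal

noncomputable section

/-- The absolute value of the local field `k` is the normalized one: it is the factor by which
multiplication by `a` scales the additive Haar measure `ν` of `k`. (This is the usual absolute value
of `ℝ`, and `q ^ (-v a)` for a non-archimedean `k` with residue field of order `q`. No norm on the
field of complex numbers has this property.) -/
def IsNormalizedAbs {k : Type*} [NormedField k] [MeasurableSpace k] (ν : Measure k) : Prop :=
  ∀ (a : k) (s : Set k), ν ((fun t => a * t) '' s) = ‖a‖ₑ * ν s

/-- The gradient `∇f(x) = (∂f/∂x_1, …, ∂f/∂x_m)`. The type `Fin m → k` carries the norm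
`max_i |x_i|`, and this is the norm used for gradients. -/
def polyGrad {k : Type*} [CommRing k] {m : ℕ} (f : MvPolynomial (Fin m) k) (x : Fin m → k) :
    Fin m → k :=
  fun i => MvPolynomial.eval x (MvPolynomial.pderiv i f)

/-- The level set `L_c = {x | f(x) = c}`. -/
def levelSet {k : Type*} [CommRing k] {m : ℕ} (f : MvPolynomial (Fin m) k) (c : k) :
    Set (Fin m → k) :=
  {x | MvPolynomial.eval x f = c}

/-- `L_{c,i} = {x ∈ L_c | ∂f/∂x_i (x) ≠ 0}`. The projection `π_i` that omits the `i`-th coordinate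
is a local analytic isomorphism from `L_{c,i}` to `k^{m-1}`. -/
def levelChart {k : Type*} [CommRing k] {m : ℕ} (f : MvPolynomial (Fin m) k) (c : k) (i : Fin m) :
    Set (Fin m → k) :=
  {x | x ∈ levelSet f c ∧ polyGrad f x i ≠ 0}

/-- The points of `L_c` where the gradient does not vanish and `i` is the first index at which
`max_j |∂f/∂x_j|` is attained. These sets form a finite Borel partition of the smooth part
`L_c' = ⋃ i, L_{c,i}` of `L_c`, and the `i`-th one is contained in `L_{c,i}`. -/
def levelPiece {k : Type*} [NormedField k] {m : ℕ} (f : MvPolynomial (Fin m) k) (c : k)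
    (i : Fin m) : Set (Fin m → k) :=
  {x | x ∈ levelChart f c i ∧ (∀ j, ‖polyGrad f x j‖ ≤ ‖polyGrad f x i‖) ∧
    ∀ j < i, ‖polyGrad f x j‖ < ‖polyGrad f x i‖}

/-- For `y ∈ k^{m-1}`, the sum of `|∂f/∂x_i (x)|⁻¹` over the points `x` of `A ∩ L_{c,i}` with
`π_i(x) = y`; these `x` are obtained from `y` by inserting a coordinate `t` at position `i`. -/
def fibreSum {k : Type*} [NormedField k] {n : ℕ} (f : MvPolynomial (Fin (n + 1)) k) (c : k)
    (i : Fin (n + 1)) (A : Set (Fin (n + 1) → k)) (y : Fin n → k) : ℝ≥0∞ :=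
  ∑' t : k, (A ∩ levelChart f c i).indicator (fun x => ‖polyGrad f x i‖ₑ⁻¹)
    (i.insertNth (α := fun _ => k) t y)

/-! ### Countable additivity of `A ↦ ∫ fibreSum f c i A y dy` -/

section Measurability

variable {k : Type*} [NontriviallyNormedField k] {n : ℕ}

theorem continuous_polyGrad_apply {m : ℕ} (f : MvPolynomial (Fin m) k) (i : Fin m) :
    Continuous fun x : Fin m → k => polyGrad f x i :=
  MvPolynomial.continuous_eval _

theorem hasStrictFDerivAt_eval {m : ℕ} (f : MvPolynomial (Fin m) k) (x : Fin m → k) :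
    HasStrictFDerivAt (fun z : Fin m → k => MvPolynomial.eval z f)
      (∑ j, polyGrad f x j • ContinuousLinearMap.proj (R := k) (φ := fun _ : Fin m => k) j) x := by
  induction f using MvPolynomial.induction_on with
  | C a =>
    have h := hasStrictFDerivAt_const (𝕜 := k) a x
    simp only [MvPolynomial.eval_C]
    refine h.congr_fderiv ?_
    refine ContinuousLinearMap.ext fun v => ?_
    simp [polyGrad, sum_apply]
  | add p q hp hq =>
    have h := hp.fun_add hq
    simp only [map_add]
    refine h.congr_fderiv ?_
    refine ContinuousLinearMap.ext fun v => ?_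
    simp [polyGrad, sum_apply, add_mul, Finset.sum_add_distrib]
  | mul_X p j hp =>
    have h := hp.fun_mul (hasStrictFDerivAt_apply (𝕜 := k) j x)
    simp only [map_mul, MvPolynomial.eval_X]
    refine h.congr_fderiv ?_
    have hg : ∀ l, polyGrad (p * MvPolynomial.X j) x l
        = MvPolynomial.eval x p * (if l = j then 1 else 0) + x j * polyGrad p x l := by
      intro l
      by_cases hl : l = j
      · subst hl
        simp [polyGrad, Derivation.leibniz, MvPolynomial.pderiv_X]
      · simp [polyGrad, Derivation.leibniz, MvPolynomial.pderiv_X, hl, Ne.symm hl]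
    refine ContinuousLinearMap.ext fun v => ?_
    simp [hg, sum_apply, add_mul, Finset.sum_add_distrib, Finset.mul_sum, mul_assoc]

/-- The projection omitting the `i`-th coordinate is locally injective on `L_{c,i}`. -/
theorem exists_nhds_injOn_levelChart (f : MvPolynomial (Fin (n + 1)) k) (c : k) (i : Fin (n + 1))
    (x : Fin (n + 1) → k) (hx : x ∈ levelChart f c i) :
    ∃ U ∈ 𝓝 x, InjOn (fun z : Fin (n + 1) → k => i.removeNth z) (U ∩ levelChart f c i) := by
  have hpos : 0 < ‖polyGrad f x i‖ / 2 := half_pos (norm_pos_iff.2 hx.2)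
  have h := (hasStrictFDerivAt_eval f x).isLittleO.def hpos
  rw [nhds_prod_eq] at h
  obtain ⟨U, hU, hUU⟩ := Filter.eventually_prod_self_iff'.1 h
  refine ⟨U, hU, fun a ha b hb hab => ?_⟩
  have hsub : a - b = Pi.single i (a i - b i) := by
    ext j
    rcases eq_or_ne j i with rfl | hj
    · simp
    · obtain ⟨l, rfl⟩ := Fin.exists_succAbove_eq hj
      have := congrFun hab l
      simp only [Fin.removeNth] at this
      simp [this]
  have key := hUU a ha.1 b hb.1
  have e1 : MvPolynomial.eval a f - MvPolynomial.eval b f = 0 := by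
    rw [show MvPolynomial.eval a f = c from ha.2.1, show MvPolynomial.eval b f = c from hb.2.1,
      sub_self]
  simp only [e1, hsub] at key
  have e2 : (∑ j, polyGrad f x j • ContinuousLinearMap.proj (R := k)
      (φ := fun _ : Fin (n + 1) => k) j) (Pi.single i (a i - b i))
      = polyGrad f x i * (a i - b i) := by
    simp [sum_apply, Pi.single_apply]
  rw [e2, Pi.norm_single, zero_sub, norm_neg, norm_mul] at key
  have h0 : ‖a i - b i‖ = 0 := by
    have := norm_nonneg (a i - b i)
    have := norm_pos_iff.2 hx.2
    nlinarith
  have h1 : a i - b i = 0 := norm_eq_zero.1 h0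
  rw [h1, Pi.single_zero] at hsub
  exact sub_eq_zero.1 hsub

theorem fibreSum_iUnion (f : MvPolynomial (Fin (n + 1)) k) (c : k) (i : Fin (n + 1))
    (A : ℕ → Set (Fin (n + 1) → k)) (hd : Pairwise (Function.onFun Disjoint A)) (y : Fin n → k) :
    fibreSum f c i (⋃ q, A q) y = ∑' q, fibreSum f c i (A q) y := by
  unfold fibreSum
  rw [ENNReal.tsum_comm]
  refine tsum_congr fun t => ?_
  set x := i.insertNth (α := fun _ => k) t y
  by_cases hx : x ∈ (⋃ q, A q) ∩ levelChart f c i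
  · obtain ⟨q, hq⟩ := mem_iUnion.1 hx.1
    rw [indicator_of_mem hx, tsum_eq_single q, indicator_of_mem (show x ∈ A q ∩ levelChart f c i from ⟨hq, hx.2⟩)]
    intro q' hq'
    rw [indicator_of_notMem]
    exact fun h => disjoint_left.1 (hd hq') h.1 hq
  · rw [indicator_of_notMem hx, eq_comm, ENNReal.tsum_eq_zero]
    intro q
    exact indicator_of_notMem (fun h => hx ⟨mem_iUnion.2 ⟨q, h.1⟩, h.2⟩) _

variable [MeasurableSpace k] [BorelSpace k] [ProperSpace k]

theorem measurableSet_levelChart {m : ℕ} (f : MvPolynomial (Fin m) k) (c : k) (i : Fin m) :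
    MeasurableSet (levelChart f c i) :=
  (measurableSet_eq_fun (MvPolynomial.continuous_eval f).measurable measurable_const).inter
    (measurableSet_eq_fun (continuous_polyGrad_apply f i).measurable measurable_const).compl

theorem measurable_fibreSum_of_injOn (f : MvPolynomial (Fin (n + 1)) k) (c : k) (i : Fin (n + 1))
    {A : Set (Fin (n + 1) → k)} (hA : MeasurableSet A)
    (hinj : InjOn (fun z : Fin (n + 1) → k => i.removeNth z) (A ∩ levelChart f c i)) :
    Measurable (fibreSum f c i A) := by
  set E := A ∩ levelChart f c i with hE
  have hEm : MeasurableSet E := hA.inter (measurableSet_levelChart f c i)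
  set g : (Fin (n + 1) → k) → ℝ≥0∞ := fun x => ‖polyGrad f x i‖ₑ⁻¹ with hg
  have hgm : Measurable g := (continuous_polyGrad_apply f i).measurable.enorm.inv
  have hval : ∀ x ∈ E, fibreSum f c i A (i.removeNth x) = g x := by
    intro x hx
    unfold fibreSum
    rw [tsum_eq_single (x i)]
    · rw [Fin.insertNth_self_removeNth, indicator_of_mem hx]
    · intro t ht
      rw [indicator_of_notMem]
      intro hmem
      have := hinj hmem hx (by simp)
      exact ht (by rw [← this]; simp)
  have hproj : Measurable fun z : Fin (n + 1) → k => i.removeNth z :=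
    measurable_pi_lambda _ fun j => measurable_pi_apply _
  refine measurable_of_Ioi fun a => ?_
  have hset : fibreSum f c i A ⁻¹' Ioi a
      = (fun z : Fin (n + 1) → k => i.removeNth z) '' (E ∩ g ⁻¹' Ioi a) := by
    ext y
    constructor
    · intro hy
      have hne : fibreSum f c i A y ≠ 0 := (lt_of_le_of_lt bot_le hy).ne'
      obtain ⟨t, ht⟩ : ∃ t : k, i.insertNth (α := fun _ => k) t y ∈ E := by
        by_contra! hcon
        exact hne (by
          unfold fibreSum
          simp only [ENNReal.tsum_eq_zero]
          exact fun t => indicator_of_notMem (hcon t) _)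
      refine ⟨_, ⟨ht, ?_⟩, by simp⟩
      have := hval _ ht
      rw [Fin.removeNth_insertNth] at this
      rw [mem_preimage, ← this]
      exact hy
    · rintro ⟨x, ⟨hxE, hxa⟩, rfl⟩
      rw [mem_preimage, hval x hxE]
      exact hxa
  rw [hset]
  exact (hEm.inter (hgm measurableSet_Ioi)).image_of_measurable_injOn hproj
    (hinj.mono inter_subset_left)

theorem measurable_fibreSum (f : MvPolynomial (Fin (n + 1)) k) (c : k) (i : Fin (n + 1))
    {A : Set (Fin (n + 1) → k)} (hA : MeasurableSet A) : Measurable (fibreSum f c i A) := by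
  have hloc : ∀ x : levelChart f c i, ∃ U : Set (Fin (n + 1) → k), IsOpen U ∧ x.1 ∈ U ∧
      InjOn (fun z : Fin (n + 1) → k => i.removeNth z) (U ∩ levelChart f c i) := by
    intro x
    obtain ⟨U, hU, hinj⟩ := exists_nhds_injOn_levelChart f c i x.1 x.2
    obtain ⟨V, hVU, hV, hxV⟩ := mem_nhds_iff.1 hU
    exact ⟨V, hV, hxV, hinj.mono (inter_subset_inter_left _ hVU)⟩
  choose U hUo hxU hUinj using hloc
  obtain ⟨T, hT, hTU⟩ := TopologicalSpace.isOpen_iUnion_countable U hUo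
  have hcov : levelChart f c i ⊆ ⋃ x ∈ T, U x := by
    rw [hTU]
    exact fun x hx => mem_iUnion.2 ⟨⟨x, hx⟩, hxU _⟩
  -- an enumeration of the countably many neighbourhoods, padded by the empty set
  obtain ⟨O, hO⟩ : ∃ O : ℕ → Set (Fin (n + 1) → k), (∀ q, IsOpen (O q)) ∧
      (∀ q, InjOn (fun z : Fin (n + 1) → k => i.removeNth z) (O q ∩ levelChart f c i)) ∧
      levelChart f c i ⊆ ⋃ q, O q := by
    rcases T.eq_empty_or_nonempty with hTe | hTn
    · refine ⟨fun _ => ∅, fun _ => isOpen_empty, fun _ => by simp, ?_⟩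
      simpa [hTe] using hcov
    · obtain ⟨e, he⟩ := hT.exists_eq_range hTn
      refine ⟨fun q => U (e q), fun q => hUo _, fun q => hUinj _, ?_⟩
      rw [he, biUnion_range] at hcov
      exact hcov
  obtain ⟨hOo, hOinj, hOcov⟩ := hO
  have hdisj := disjoint_disjointed O
  have hsplit : fibreSum f c i A = fun y => ∑' q, fibreSum f c i (A ∩ disjointed O q) y := by
    funext y
    rw [← fibreSum_iUnion f c i (fun q => A ∩ disjointed O q)
      (fun a b hab => (hdisj hab).mono inter_subset_right inter_subset_right) y,
      ← inter_iUnion, iUnion_disjointed]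
    unfold fibreSum
    rw [show (A ∩ ⋃ q, O q) ∩ levelChart f c i = A ∩ levelChart f c i by
      rw [inter_assoc, inter_eq_self_of_subset_right hOcov]]
  rw [hsplit]
  refine Measurable.tsum fun q => ?_
  refine measurable_fibreSum_of_injOn f c i
    (hA.inter (MeasurableSet.disjointed (fun q => (hOo q).measurableSet) q)) ?_
  exact (hOinj q).mono (inter_subset_inter_left _
    (inter_subset_right.trans (disjointed_subset O q)))

end Measurability

/-! ### The canonical measures -/

/-- The measure `|∂f/∂x_i|⁻¹ |π_i^* (dy)|` on `L_{c,i}`, as a Borel measure on `k^m` (with `m = n + 1`):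
a Borel set `A` has the measure `∫_{k^{m-1}} ∑_{x ∈ A ∩ L_{c,i}, π_i(x) = y} |∂f/∂x_i (x)|⁻¹ dy`,
where `dy` is the product of `m - 1` copies of the Haar measure `ν` of `k`. -/
def chartMeasure {k : Type*} [NontriviallyNormedField k] [LocallyCompactSpace k]
    [MeasurableSpace k] [BorelSpace k] (ν : Measure k) {n : ℕ}
    (f : MvPolynomial (Fin (n + 1)) k) (c : k) (i : Fin (n + 1)) : Measure (Fin (n + 1) → k) :=
  Measure.ofMeasurable (fun A _ => ∫⁻ y, fibreSum f c i A y ∂(Measure.pi fun _ : Fin n => ν))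
    (by simp [fibreSum])
    (by
      have : ProperSpace k := ProperSpace.of_locallyCompactSpace k
      intro A hA hd
      simp only [fibreSum_iUnion f c i A hd]
      exact lintegral_tsum fun q => (measurable_fibreSum f c i (hA q)).aemeasurable)

theorem chartMeasure_apply {k : Type*} [NontriviallyNormedField k] [LocallyCompactSpace k]
    [MeasurableSpace k] [BorelSpace k] (ν : Measure k) {n : ℕ}
    (f : MvPolynomial (Fin (n + 1)) k) (c : k) (i : Fin (n + 1)) {A : Set (Fin (n + 1) → k)}
    (hA : MeasurableSet A) :
    chartMeasure ν f c i A = ∫⁻ y, fibreSum f c i A y ∂(Measure.pi fun _ : Fin n => ν) :=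
  Measure.ofMeasurable_apply A hA

/-- The canonical measure `μ_{f,c}` on the smooth part `L_c' = {x ∈ L_c | ∇f(x) ≠ 0}` of the level
set, regarded as a Borel measure on `k^m` (where `m = n + 1`) that vanishes off `L_c'`. It is the
measure defined by `|ρ|`, where `ρ = (dx_1 ∧ … ∧ dx_m) / df` is the quotient form on `L_c'`. In the
chart `π_i` of `L_{c,i}` one has `|ρ| = |∂f/∂x_i|⁻¹ |π_i^* (dy)|`, and these expressions agree on
overlaps; so the measure is computed by cutting `L_c'` into finitely many Borel pieces, each inside
one `L_{c,i}`, and using the chart `π_i` on it. -/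
def canonicalMeasure {k : Type*} [NontriviallyNormedField k] [LocallyCompactSpace k]
    [MeasurableSpace k] [BorelSpace k] (ν : Measure k) {n : ℕ}
    (f : MvPolynomial (Fin (n + 1)) k) (c : k) : Measure (Fin (n + 1) → k) :=
  ∑ i, (chartMeasure ν f c i).restrict (levelPiece f c i)

end

/-! ### Homogeneity -/

/-! Every upper bound comes from one estimate. A line in direction `i` meets the chart `L_{c,i}` in
at most `deg f` points, and on the `i`-th piece `|∂f/∂x_i|` equals the max-norm of the gradient. So
if `‖∇f‖ ≥ δ` and `‖x‖ ≤ r` on `A ∩ L_c`, then `μ_{f,c}(A)` is at most a constant times `δ⁻¹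
r^(m-1)`, uniformly in `c` (`IsNormalizedAbs.exists_canonicalMeasure_le`). What remains is to bound
the gradient from below.

Compactness and homogeneity give `ε ‖x‖^d ≤ max |f(x)| (‖x‖ ‖∇f(x)‖)`
(`exists_mul_norm_pow_le_max`). On `L_0` this reads `‖∇f(x)‖ ≥ ε ‖x‖^(d-1)`. On `L_c` with `c` in a
compact `W` avoiding `0`, it bounds the gradient for large `x`, while Euler's identity `∑ x_i
∂f/∂x_i = d f` bounds it for the remaining `x`, because `d ≠ 0` in characteristic `0`.

Near the origin the shell of radius `θ^j` in `L_0` has mass `O(θ^(j(m-d)))`, which is summable for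
`m > d`. Conversely, scaling by `b` sends a small smooth patch of the cone to one whose mass is at
least a constant times `|b|^(m-d)`; for `m < d` this is unbounded as `b → 0`, and the quartic is
such a case. -/

theorem MvPolynomial.IsHomogeneous.eval_smul_eq {k σ : Type*} [CommRing k]
    {f : MvPolynomial σ k} {d : ℕ} (hf : f.IsHomogeneous d) (t : k) (x : σ → k) :
    MvPolynomial.eval (t • x) f = t ^ d * MvPolynomial.eval x f := by
  rw [MvPolynomial.eval_eq, MvPolynomial.eval_eq, Finset.mul_sum]
  refine Finset.sum_congr rfl fun s hs => ?_
  rw [hf.degree_eq_sum_deg_support hs]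
  simp only [Pi.smul_apply, smul_eq_mul, mul_pow, Finset.prod_mul_distrib, Finset.prod_pow_eq_pow_sum]
  ring

theorem polyGrad_smul {k : Type*} [CommRing k] {m d : ℕ} {f : MvPolynomial (Fin m) k}
    (hf : f.IsHomogeneous d) (t : k) (x : Fin m → k) :
    polyGrad f (t • x) = t ^ (d - 1) • polyGrad f x := by
  funext i
  exact (hf.pderiv (i := i)).eval_smul_eq t x

theorem polyGrad_zero_of_isHomogeneous {k : Type*} [CommRing k] {m d : ℕ}
    {f : MvPolynomial (Fin m) k} (hf : f.IsHomogeneous d) (hd : 2 ≤ d) :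
    polyGrad f 0 = 0 := by
  have h := polyGrad_smul hf 0 (0 : Fin m → k)
  rwa [zero_pow (by omega), zero_smul, zero_smul] at h

theorem sum_mul_polyGrad {k : Type*} [CommRing k] {m d : ℕ} {f : MvPolynomial (Fin m) k}
    (hf : f.IsHomogeneous d) (x : Fin m → k) :
    ∑ i, x i * polyGrad f x i = d * MvPolynomial.eval x f := by
  have h := congrArg (MvPolynomial.eval x) hf.sum_X_mul_pderiv
  simpa [polyGrad, map_sum] using h

section Gradient

variable {k : Type*} [NontriviallyNormedField k]

theorem continuous_polyGrad {m : ℕ} (f : MvPolynomial (Fin m) k) : Continuous (polyGrad f) :=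
  continuous_pi fun i => continuous_polyGrad_apply f i

/-- Euler's identity in quantitative form. It controls the gradient from below at bounded points
where `f` is not small. -/
theorem norm_mul_norm_eval_le {m d : ℕ} {f : MvPolynomial (Fin m) k} (hf : f.IsHomogeneous d)
    (x : Fin m → k) :
    ‖(d : k)‖ * ‖MvPolynomial.eval x f‖ ≤ m * (‖x‖ * ‖polyGrad f x‖) := by
  rw [← norm_mul, ← sum_mul_polyGrad hf x]
  refine (norm_sum_le _ _).trans ?_
  refine (Finset.sum_le_card_nsmul _ _ (‖x‖ * ‖polyGrad f x‖) fun i _ => ?_).trans (by simp)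
  rw [norm_mul]
  exact mul_le_mul (norm_le_pi_norm _ _) (norm_le_pi_norm _ _) (norm_nonneg _) (norm_nonneg _)

/-- If `0` is the only singular point of `L_0`, then `f` and its gradient are not small
simultaneously. -/
theorem exists_mul_norm_pow_le_max [ProperSpace k] {m d : ℕ} {f : MvPolynomial (Fin m) k}
    (hd : 1 ≤ d) (hf : f.IsHomogeneous d)
    (hs : ∀ x ∈ levelSet f 0, polyGrad f x = 0 → x = 0) :
    ∃ ε : ℝ, 0 < ε ∧ ∀ x, ε * ‖x‖ ^ d ≤ max ‖MvPolynomial.eval x f‖ (‖x‖ * ‖polyGrad f x‖) := by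
  obtain ⟨a, ha⟩ := NormedField.exists_one_lt_norm k
  have ha0 : 0 < ‖a‖ := one_pos.trans ha
  -- A compact shell that contains a scalar multiple of every nonzero vector.
  set S : Set (Fin m → k) := {x | ‖x‖ ∈ Icc (1 / ‖a‖) 1}
  have hS : IsCompact S := by
    refine (isCompact_closedBall (0 : Fin m → k) 1).of_isClosed_subset
      (isClosed_Icc.preimage continuous_norm) fun x hx => ?_
    simpa using hx.2
  set g : (Fin m → k) → ℝ := fun x => max ‖MvPolynomial.eval x f‖ (‖x‖ * ‖polyGrad f x‖) with hg
  have hgc : Continuous g :=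
    (MvPolynomial.continuous_eval f).norm.max (continuous_norm.mul (continuous_polyGrad f).norm)
  have hnorm : ∀ x ∈ S, 0 < ‖x‖ := fun x hx => (by positivity : 0 < 1 / ‖a‖).trans_le hx.1
  have hgpos : ∀ x ∈ S, 0 < g x := by
    intro x hx
    by_contra! h
    have h1 : MvPolynomial.eval x f = 0 := norm_le_zero_iff.1 ((le_max_left _ _).trans h)
    have h2 : ‖x‖ * ‖polyGrad f x‖ ≤ 0 := (le_max_right _ _).trans h
    have h3 : polyGrad f x = 0 := by
      have := hnorm x hx
      have := norm_nonneg (polyGrad f x)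
      exact norm_le_zero_iff.1 (by nlinarith)
    have := hs x h1 h3
    exact (hnorm x hx).ne' (by simp [this])
  obtain ⟨ε, hε, hεg⟩ : ∃ ε : ℝ, 0 < ε ∧ ∀ x ∈ S, ε ≤ g x := by
    rcases S.eq_empty_or_nonempty with h | h
    · exact ⟨1, one_pos, by simp [h]⟩
    · obtain ⟨x, hx, hmin⟩ := hS.exists_isMinOn h hgc.continuousOn
      exact ⟨g x, hgpos x hx, fun y hy => hmin hy⟩
  refine ⟨ε, hε, fun x => ?_⟩
  rcases eq_or_ne x 0 with rfl | hx
  · rw [norm_zero, zero_pow (by omega), mul_zero]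
    exact le_max_of_le_left (norm_nonneg _)
  obtain ⟨t, ht0, ht1, ht2, -⟩ := rescale_to_shell ha one_pos hx
  have htpos : 0 < ‖t‖ := norm_pos_iff.2 ht0
  have key := hεg (t • x) ⟨ht2, ht1.le⟩
  -- The factor `‖x‖` in front of the gradient makes both entries of the maximum scale by the same
  -- power `‖t‖ ^ d`.
  have hgt : g (t • x) = ‖t‖ ^ d * g x := by
    simp only [hg, hf.eval_smul_eq, polyGrad_smul hf, norm_mul, norm_smul, norm_pow]
    rw [mul_max_of_nonneg _ _ (by positivity)]
    congr 1
    obtain ⟨e, rfl⟩ := Nat.exists_eq_add_of_le' hd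
    simp only [Nat.add_sub_cancel, pow_succ]
    ring
  rw [hgt] at key
  have h1 : ‖t‖ * ‖x‖ ≤ 1 := by rw [← norm_smul]; exact ht1.le
  have h2 : ‖t‖ ^ d * (ε * ‖x‖ ^ d) ≤ ‖t‖ ^ d * g x := by
    calc ‖t‖ ^ d * (ε * ‖x‖ ^ d) = ε * (‖t‖ * ‖x‖) ^ d := by ring
      _ ≤ ε * 1 := by gcongr; exact pow_le_one₀ (by positivity) h1
      _ ≤ _ := by simpa using key
  exact le_of_mul_le_mul_left h2 (by positivity)

theorem exists_mul_norm_pow_le_norm_polyGrad [ProperSpace k] {m d : ℕ}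
    {f : MvPolynomial (Fin m) k} (hd : 2 ≤ d) (hf : f.IsHomogeneous d)
    (hs : ∀ x ∈ levelSet f 0, polyGrad f x = 0 → x = 0) :
    ∃ ε : ℝ, 0 < ε ∧ ∀ x ∈ levelSet f 0, ε * ‖x‖ ^ (d - 1) ≤ ‖polyGrad f x‖ := by
  obtain ⟨ε, hε, h⟩ := exists_mul_norm_pow_le_max (by omega) hf hs
  refine ⟨ε, hε, fun x hx => ?_⟩
  rcases eq_or_ne x 0 with rfl | hx0
  · simp [zero_pow (show d - 1 ≠ 0 by omega)]
  have h1 := h x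
  rw [show MvPolynomial.eval x f = 0 from hx, norm_zero, max_eq_right (by positivity)] at h1
  have hxp : 0 < ‖x‖ := norm_pos_iff.2 hx0
  refine le_of_mul_le_mul_left (le_trans (le_of_eq ?_) h1) hxp
  conv_rhs => rw [show d = d - 1 + 1 by omega, pow_succ]
  ring

/-- Far out, `|f| = |c|` is too small to attain the maximum in `exists_mul_norm_pow_le_max`, so the
gradient term does. At bounded points Euler's identity applies, with `|c|` bounded away from `0`. No
restriction to `‖x‖ ≥ 1` is needed. -/
theorem exists_le_norm_polyGrad [ProperSpace k] [CharZero k] {m d : ℕ}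
    {f : MvPolynomial (Fin m) k} (hd : 1 ≤ d) (hf : f.IsHomogeneous d)
    (hs : ∀ x ∈ levelSet f 0, polyGrad f x = 0 → x = 0) {W : Set k} (hW : IsCompact W)
    (hW0 : 0 ∉ W) :
    ∃ δ : ℝ, 0 < δ ∧ ∀ c ∈ W, ∀ x ∈ levelSet f c, δ ≤ ‖polyGrad f x‖ := by
  obtain ⟨ε, hε, h⟩ := exists_mul_norm_pow_le_max hd hf hs
  obtain ⟨M, hM⟩ := hW.isBounded.exists_norm_le
  obtain ⟨w, hw, hwW⟩ : ∃ w : ℝ, 0 < w ∧ ∀ c ∈ W, w ≤ ‖c‖ := by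
    obtain ⟨w, hw, hb⟩ := Metric.isOpen_iff.1 hW.isClosed.isOpen_compl 0 hW0
    refine ⟨w, hw, fun c hc => ?_⟩
    by_contra! hcw
    exact hb (by simpa using hcw) hc
  have hdk : 0 < ‖(d : k)‖ := norm_pos_iff.2 (Nat.cast_ne_zero.2 (by omega))
  -- Beyond this radius `|c| ≤ M < ε ‖x‖ ≤ ε ‖x‖ ^ d`. The `m + 1` in the constant below keeps the
  -- denominator positive also for `m = 0`.
  set ρ : ℝ := max 1 (M / ε)
  have hρ : 1 ≤ ρ := le_max_left _ _
  have hρ0 : 0 < ρ := by linarith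
  refine ⟨min ε (‖(d : k)‖ * w / ((m + 1) * ρ)), lt_min hε (by positivity), ?_⟩
  intro c hc x hx
  have hx' : MvPolynomial.eval x f = c := hx
  have hG := norm_nonneg (polyGrad f x)
  rcases le_or_gt ‖x‖ ρ with hxρ | hxρ
  · refine (min_le_right _ _).trans ?_
    rw [div_le_iff₀ (by positivity)]
    have := norm_mul_norm_eval_le hf x
    rw [hx'] at this
    calc ‖(d : k)‖ * w ≤ ‖(d : k)‖ * ‖c‖ := by gcongr; exact hwW c hc
      _ ≤ m * (‖x‖ * ‖polyGrad f x‖) := this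
      _ ≤ (m + 1) * (ρ * ‖polyGrad f x‖) := by gcongr; linarith
      _ = _ := by ring
  · refine (min_le_left _ _).trans ?_
    have h1 : 1 ≤ ‖x‖ := hρ.trans hxρ.le
    have hpow : ‖x‖ ≤ ‖x‖ ^ d := le_self_pow₀ h1 (by omega)
    have h2 : M < ε * ‖x‖ := by
      have := (le_max_right 1 (M / ε)).trans_lt hxρ
      rw [div_lt_iff₀ hε] at this
      linarith
    have h3 : ‖MvPolynomial.eval x f‖ < ε * ‖x‖ ^ d := by
      rw [hx']
      exact (hM c hc).trans_lt (h2.trans_le (by gcongr))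
    have h4 : ε * ‖x‖ ^ d ≤ ‖x‖ * ‖polyGrad f x‖ := by
      rcases le_max_iff.1 (h x) with h5 | h5
      · exact absurd h5 (not_le.2 h3)
      · exact h5
    have h5 : ε * ‖x‖ ≤ ε * ‖x‖ ^ d := by gcongr
    nlinarith

/-! ### Comparison of norms -/

theorem Seminorm.exists_le_mul_norm_pi {ι : Type*} [Fintype ι] (N : Seminorm k (ι → k)) :
    ∃ C : ℝ, 0 < C ∧ ∀ x, N x ≤ C * ‖x‖ := by
  classical
  refine ⟨∑ i, N (Pi.single i 1) + 1,
    add_pos_of_nonneg_of_pos (Finset.sum_nonneg fun i _ => apply_nonneg N _) one_pos, fun x => ?_⟩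
  have hx : x = ∑ i, x i • (Pi.single i 1 : ι → k) := by
    ext j
    simp [Finset.sum_apply, Pi.single_apply]
  have h1 : N x ≤ ∑ i, ‖x‖ * N (Pi.single i 1) := by
    conv_lhs => rw [hx]
    refine (Finset.le_sum_of_subadditive N (map_zero N).le (map_add_le_add N) _ _).trans ?_
    refine Finset.sum_le_sum fun i _ => ?_
    rw [map_smul_eq_mul]
    exact mul_le_mul_of_nonneg_right (norm_le_pi_norm x i) (apply_nonneg N _)
  rw [← Finset.mul_sum] at h1
  nlinarith [norm_nonneg x]

theorem Seminorm.continuous_pi {ι : Type*} [Fintype ι] (N : Seminorm k (ι → k)) :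
    Continuous N := by
  obtain ⟨C, hC, hNC⟩ := N.exists_le_mul_norm_pi
  refine LipschitzWith.continuous (K := ⟨C, hC.le⟩) (LipschitzWith.of_dist_le_mul fun x y => ?_)
  rw [Real.dist_eq, dist_eq_norm]
  exact (abs_sub_map_le_sub N x y).trans (hNC _)

/-- A definite `N` has a positive minimum on a compact shell, and homogeneity spreads the bound to
all vectors. This transfers estimates from the max-norm to an arbitrary norm. -/
theorem Seminorm.exists_mul_norm_pi_le [ProperSpace k] {ι : Type*} [Fintype ι]
    (N : Seminorm k (ι → k)) (hN : ∀ x, N x = 0 → x = 0) :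
    ∃ c : ℝ, 0 < c ∧ ∀ x, c * ‖x‖ ≤ N x := by
  obtain ⟨a, ha⟩ := NormedField.exists_one_lt_norm k
  have ha0 : 0 < ‖a‖ := one_pos.trans ha
  set S : Set (ι → k) := {x | ‖x‖ ∈ Icc (1 / ‖a‖) 1}
  have hS : IsCompact S := by
    refine (isCompact_closedBall (0 : ι → k) 1).of_isClosed_subset
      (isClosed_Icc.preimage continuous_norm) fun x hx => ?_
    simpa using hx.2
  obtain ⟨ε, hε, hεN⟩ : ∃ ε : ℝ, 0 < ε ∧ ∀ x ∈ S, ε ≤ N x := by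
    rcases S.eq_empty_or_nonempty with h | h
    · exact ⟨1, one_pos, by simp [h]⟩
    · obtain ⟨x, hx, hmin⟩ := hS.exists_isMinOn h N.continuous_pi.continuousOn
      refine ⟨N x, (apply_nonneg N x).lt_of_ne' fun h0 => ?_, fun y hy => hmin hy⟩
      have : 0 < ‖x‖ := (by positivity : 0 < 1 / ‖a‖).trans_le hx.1
      simp [hN x h0] at this
  refine ⟨ε, hε, fun x => ?_⟩
  rcases eq_or_ne x 0 with rfl | hx
  · simp
  obtain ⟨t, ht0, ht1, ht2, -⟩ := _root_.rescale_to_shell ha one_pos hx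
  have htpos : 0 < ‖t‖ := norm_pos_iff.2 ht0
  have key := hεN (t • x) ⟨ht2, ht1.le⟩
  rw [map_smul_eq_mul] at key
  rw [norm_smul] at ht1
  refine le_of_mul_le_mul_left ?_ htpos
  nlinarith

end Gradient

/-! ### Fibres of the projections -/

/-- Restriction of `f` to a line in direction `i` yields a one-variable polynomial; fibres of `π_i`
are root sets of such polynomials. -/
theorem MvPolynomial.derivative_aeval_insertNth {k : Type*} [CommRing k] {n : ℕ}
    (i : Fin (n + 1)) (y : Fin n → k) (f : MvPolynomial (Fin (n + 1)) k) :
    Polynomial.derivative (MvPolynomial.aeval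
        (i.insertNth (α := fun _ => Polynomial k) Polynomial.X fun j => Polynomial.C (y j)) f)
      = MvPolynomial.aeval
        (i.insertNth (α := fun _ => Polynomial k) Polynomial.X fun j => Polynomial.C (y j))
        (MvPolynomial.pderiv i f) := by
  induction f using MvPolynomial.induction_on with
  | C a => simp
  | add p q hp hq => simp [hp, hq]
  | mul_X p j hp =>
    rw [MvPolynomial.pderiv_mul, map_mul, Polynomial.derivative_mul, hp, map_add, map_mul, map_mul]
    congr 2
    rcases eq_or_ne j i with rfl | hj
    · simp
    · rw [MvPolynomial.pderiv_X_of_ne hj, MvPolynomial.aeval_X]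
      obtain ⟨l, rfl⟩ := Fin.exists_succAbove_eq hj
      simp

theorem MvPolynomial.eval_aeval_insertNth {k : Type*} [CommRing k] {n : ℕ}
    (i : Fin (n + 1)) (y : Fin n → k) (f : MvPolynomial (Fin (n + 1)) k) (t : k) :
    Polynomial.eval t (MvPolynomial.aeval
        (i.insertNth (α := fun _ => Polynomial k) Polynomial.X fun j => Polynomial.C (y j)) f)
      = MvPolynomial.eval (i.insertNth (α := fun _ => k) t y) f := by
  induction f using MvPolynomial.induction_on with
  | C a => simp
  | add p q hp hq => simp [hp, hq]
  | mul_X p j hp =>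
    rw [map_mul, Polynomial.eval_mul, hp, map_mul, MvPolynomial.aeval_X, MvPolynomial.eval_X]
    congr 1
    refine Fin.succAboveCases i ?_ (fun l => ?_) j <;> simp

/-- A fibre of the projection `π_i` has at most `deg f` points in `L_{c,i}`. -/
theorem exists_finset_card_le_totalDegree {k : Type*} [Field k] {n : ℕ}
    (f : MvPolynomial (Fin (n + 1)) k) (c : k) (i : Fin (n + 1)) (y : Fin n → k) :
    ∃ T : Finset k, T.card ≤ f.totalDegree ∧
      ∀ t, i.insertNth (α := fun _ => k) t y ∈ levelChart f c i → t ∈ T := by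
  classical
  set p := MvPolynomial.aeval
    (i.insertNth (α := fun _ => Polynomial k) Polynomial.X fun j => Polynomial.C (y j)) f with hp
  have hdeg : p.natDegree ≤ f.totalDegree := by
    have := MvPolynomial.aeval_natDegree_le f le_rfl
      (i.insertNth (α := fun _ => Polynomial k) Polynomial.X fun j => Polynomial.C (y j))
      (n := 1) (fun j => by refine Fin.succAboveCases i ?_ (fun l => ?_) j <;> simp)
    simpa using this
  refine ⟨(p - Polynomial.C c).roots.toFinset, ?_, fun t ht => ?_⟩
  · refine (Multiset.toFinset_card_le _).trans ((Polynomial.card_roots' _).trans ?_)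
    rwa [Polynomial.natDegree_sub_C]
  · rw [Multiset.mem_toFinset, Polynomial.mem_roots']
    -- If `f - c` vanished identically on the line, so would its derivative there, which is
    -- `∂f/∂x_i`; this contradicts membership in the chart.
    refine ⟨fun h0 => ht.2 ?_, ?_⟩
    · have h1 := congrArg (fun q => Polynomial.eval t (Polynomial.derivative q)) h0
      simp only [Polynomial.derivative_sub, Polynomial.derivative_C, sub_zero,
        Polynomial.derivative_zero, Polynomial.eval_zero, hp,
        MvPolynomial.derivative_aeval_insertNth, MvPolynomial.eval_aeval_insertNth] at h1
      exact h1
    · rw [Polynomial.IsRoot.def, Polynomial.eval_sub, Polynomial.eval_C, hp,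
        MvPolynomial.eval_aeval_insertNth, sub_eq_zero]
      exact ht.1

/-! ### Upper bounds for the canonical measure -/

section Upper

variable {k : Type*} [NontriviallyNormedField k] {n : ℕ}

/-- At most `deg f` terms are nonzero, each at most `δ⁻¹`, and none is unless `‖y‖ ≤ r`, since
dropping a coordinate does not increase the max-norm. -/
theorem fibreSum_le (f : MvPolynomial (Fin (n + 1)) k) (c : k) (i : Fin (n + 1))
    (B : Set (Fin (n + 1) → k)) {δ r : ℝ} (hδ : 0 < δ)
    (hB : ∀ x ∈ B ∩ levelChart f c i, δ ≤ ‖polyGrad f x i‖ ∧ ‖x‖ ≤ r) (y : Fin n → k) :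
    fibreSum f c i B y ≤
      (Metric.closedBall 0 r).indicator (fun _ => ENNReal.ofReal (f.totalDegree * δ⁻¹)) y := by
  obtain ⟨T, hT, hTm⟩ := exists_finset_card_le_totalDegree f c i y
  unfold fibreSum
  by_cases hy : y ∈ Metric.closedBall (0 : Fin n → k) r
  · rw [indicator_of_mem hy, tsum_eq_sum (s := T)]
    · refine (Finset.sum_le_card_nsmul _ _ (ENNReal.ofReal δ⁻¹) fun t _ => ?_).trans ?_
      · refine indicator_apply_le' (fun h => ?_) fun _ => zero_le
        rw [ENNReal.ofReal_inv_of_pos hδ, ENNReal.inv_le_inv, ← ofReal_norm]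
        exact ENNReal.ofReal_le_ofReal (hB _ h).1
      · rw [nsmul_eq_mul, ENNReal.ofReal_mul (by positivity), ENNReal.ofReal_natCast]
        gcongr
    · intro t ht
      exact indicator_of_notMem (fun h => ht (hTm t h.2)) _
  · rw [indicator_of_notMem hy, nonpos_iff_eq_zero, ENNReal.tsum_eq_zero]
    intro t
    refine indicator_of_notMem (fun h => hy ?_) _
    rw [mem_closedBall_zero_iff]
    refine le_trans ?_ (hB _ h).2
    refine (pi_norm_le_iff_of_nonneg (norm_nonneg _)).2 fun j => ?_
    simpa using norm_le_pi_norm (i.insertNth (α := fun _ => k) t y) (i.succAbove j)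

theorem levelPiece.norm_eq {m : ℕ} {f : MvPolynomial (Fin m) k} {c : k} {i : Fin m}
    {x : Fin m → k} (hx : x ∈ levelPiece f c i) : ‖polyGrad f x i‖ = ‖polyGrad f x‖ :=
  le_antisymm (norm_le_pi_norm _ _) ((pi_norm_le_iff_of_nonneg (norm_nonneg _)).2 hx.2.1)

theorem IsNormalizedAbs.measure_closedBall_mul [MeasurableSpace k] [BorelSpace k] {ν : Measure k} (hν : IsNormalizedAbs ν)
    [ν.IsAddLeftInvariant] (x : k) {b : k} (hb : b ≠ 0) (r : ℝ) :
    ν (Metric.closedBall x (‖b‖ * r)) = ‖b‖ₑ * ν (Metric.closedBall 0 r) := by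
  have hb' : 0 < ‖b‖ := norm_pos_iff.2 hb
  have h1 : Metric.closedBall x (‖b‖ * r)
      = (fun t => -x + t) ⁻¹' ((fun t => b * t) '' Metric.closedBall 0 r) := by
    ext z
    simp only [Metric.mem_closedBall, mem_preimage, mem_image, dist_eq_norm, sub_zero]
    constructor
    · intro hz
      refine ⟨b⁻¹ * (-x + z), ?_, by field_simp⟩
      rw [norm_mul, norm_inv, inv_mul_le_iff₀ hb', neg_add_eq_sub]
      exact hz
    · rintro ⟨t, ht, hz⟩
      rw [← neg_add_eq_sub, ← hz, norm_mul]
      gcongr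
  rw [h1, measure_preimage_add, hν]

theorem measurableSet_levelPiece [ProperSpace k] [MeasurableSpace k] [BorelSpace k] {m : ℕ}
    (f : MvPolynomial (Fin m) k) (c : k) (i : Fin m) : MeasurableSet (levelPiece f c i) := by
  have hm : ∀ j, Measurable fun x : Fin m → k => ‖polyGrad f x j‖ := fun j =>
    (continuous_polyGrad_apply f j).norm.measurable
  have he : levelPiece f c i = levelChart f c i ∩
      ((⋂ j, {x | ‖polyGrad f x j‖ ≤ ‖polyGrad f x i‖}) ∩
        ⋂ j, ⋂ (_ : j < i), {x | ‖polyGrad f x j‖ < ‖polyGrad f x i‖}) := by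
    ext x
    simp only [levelPiece, mem_inter_iff, mem_iInter, mem_ofPred_eq]
  rw [he]
  exact (measurableSet_levelChart f c i).inter
    ((MeasurableSet.iInter fun j => measurableSet_le (hm j) (hm i)).inter
      (MeasurableSet.iInter fun j => MeasurableSet.iInter fun _ => measurableSet_lt (hm j) (hm i)))

variable [LocallyCompactSpace k] [MeasurableSpace k] [BorelSpace k]

theorem canonicalMeasure_apply (ν : Measure k) (f : MvPolynomial (Fin (n + 1)) k) (c : k)
    {A : Set (Fin (n + 1) → k)} (hA : MeasurableSet A) :
    canonicalMeasure ν f c A =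
      ∑ i, ∫⁻ y, fibreSum f c i (A ∩ levelPiece f c i) y ∂(Measure.pi fun _ : Fin n => ν) := by
  have : ProperSpace k := ProperSpace.of_locallyCompactSpace k
  rw [canonicalMeasure, Measure.finsetSum_apply]
  refine Finset.sum_congr rfl fun i _ => ?_
  rw [Measure.restrict_apply hA, chartMeasure_apply]
  exact hA.inter (measurableSet_levelPiece f c i)

/-- The canonical measure vanishes off the smooth part of the level set. -/
theorem canonicalMeasure_eq_zero (ν : Measure k) (f : MvPolynomial (Fin (n + 1)) k) (c : k)
    {A : Set (Fin (n + 1) → k)} (hA : MeasurableSet A)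
    (h : ∀ x ∈ A, x ∈ levelSet f c → polyGrad f x = 0) : canonicalMeasure ν f c A = 0 := by
  rw [canonicalMeasure_apply ν f c hA]
  refine Finset.sum_eq_zero fun i _ => ?_
  have h0 : ∀ y, fibreSum f c i (A ∩ levelPiece f c i) y = 0 := by
    intro y
    unfold fibreSum
    rw [ENNReal.tsum_eq_zero]
    intro t
    refine indicator_of_notMem (fun hx => hx.2.2 ?_) _
    rw [h _ hx.1.1 hx.2.1, Pi.zero_apply]
  simp [h0]

/-- On the `i`-th piece the `i`-th partial derivative realises `‖∇f‖`, so `fibreSum_le` applies to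
each of the `n + 1` pieces. -/
theorem canonicalMeasure_le (ν : Measure k) (f : MvPolynomial (Fin (n + 1)) k) (c : k)
    {A : Set (Fin (n + 1) → k)} (hA : MeasurableSet A) {δ r : ℝ} (hδ : 0 < δ)
    (h : ∀ x ∈ A, x ∈ levelSet f c → δ ≤ ‖polyGrad f x‖ ∧ ‖x‖ ≤ r) :
    canonicalMeasure ν f c A ≤ ENNReal.ofReal ((n + 1) * (f.totalDegree * δ⁻¹)) *
      (Measure.pi fun _ : Fin n => ν) (Metric.closedBall 0 r) := by
  have : ProperSpace k := ProperSpace.of_locallyCompactSpace k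
  rw [canonicalMeasure_apply ν f c hA]
  refine (Finset.sum_le_card_nsmul _ _ (ENNReal.ofReal (f.totalDegree * δ⁻¹) *
      (Measure.pi fun _ : Fin n => ν) (Metric.closedBall 0 r)) fun i _ => ?_).trans ?_
  · refine (lintegral_mono (fibreSum_le f c i _ hδ (r := r) fun x hx => ?_)).trans ?_
    · rw [levelPiece.norm_eq hx.1.2]
      exact h x hx.1.1 hx.2.1
    · rw [lintegral_indicator_const Metric.isClosed_closedBall.measurableSet]
  · rw [Finset.card_univ, Fintype.card_fin, nsmul_eq_mul, ENNReal.ofReal_mul (by positivity),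
      ← mul_assoc]
    gcongr
    rw [← Nat.cast_succ, ENNReal.ofReal_mul (by positivity), ENNReal.ofReal_mul (by positivity),
      ENNReal.ofReal_natCast, ENNReal.ofReal_natCast]

/-! ### Balls -/

theorem IsNormalizedAbs.exists_measure_pi_closedBall_le {ν : Measure k} (hν : IsNormalizedAbs ν)
    [ν.IsAddHaarMeasure] (n : ℕ) :
    ∃ K : ℝ, 0 ≤ K ∧ ∀ r : ℝ, 0 < r →
      (Measure.pi fun _ : Fin n => ν) (Metric.closedBall 0 r) ≤ ENNReal.ofReal (K * r ^ n) := by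
  have : ProperSpace k := ProperSpace.of_locallyCompactSpace k
  obtain ⟨a, ha⟩ := NormedField.exists_one_lt_norm k
  have ha0 : 0 < ‖a‖ := one_pos.trans ha
  have hane : a ≠ 0 := norm_pos_iff.1 ha0
  set V : ℝ := (ν (Metric.closedBall 0 1)).toReal
  have hV : ν (Metric.closedBall 0 1) = ENNReal.ofReal V :=
    (ENNReal.ofReal_toReal (isCompact_closedBall _ _).measure_lt_top.ne).symm
  have hV0 : 0 ≤ V := ENNReal.toReal_nonneg
  refine ⟨(‖a‖ * V) ^ n, by positivity, fun r hr => ?_⟩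
  -- Scaling by elements of `k` computes only radii in the value group. Rounding `r` up to a power
  -- of `‖a‖` costs a factor of at most `‖a‖` per coordinate.
  obtain ⟨q, hq1, hq2⟩ := exists_mem_Ico_zpow hr ha
  have h1 : ν (Metric.closedBall 0 r) ≤ ENNReal.ofReal (‖a‖ * V * r) := by
    calc ν (Metric.closedBall 0 r) ≤ ν (Metric.closedBall 0 (‖a ^ (q + 1)‖ * 1)) := by
          refine measure_mono (Metric.closedBall_subset_closedBall ?_)
          rw [norm_zpow, mul_one]
          exact hq2.le
      _ = ENNReal.ofReal (‖a ^ (q + 1)‖ * V) := by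
          rw [hν.measure_closedBall_mul _ (zpow_ne_zero _ hane), hV, ← ofReal_norm,
            ENNReal.ofReal_mul (norm_nonneg _)]
      _ ≤ _ := by
          refine ENNReal.ofReal_le_ofReal ?_
          rw [norm_zpow, zpow_add_one₀ ha0.ne']
          calc ‖a‖ ^ q * ‖a‖ * V ≤ r * ‖a‖ * V := by gcongr
            _ = _ := by ring
  rw [Measure.pi_closedBall _ _ hr.le]
  simp only [Pi.zero_apply, Finset.prod_const, Finset.card_univ, Fintype.card_fin]
  rw [← mul_pow, ENNReal.ofReal_pow (by positivity)]
  gcongr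

theorem IsNormalizedAbs.exists_canonicalMeasure_le {ν : Measure k} (hν : IsNormalizedAbs ν)
    [ν.IsAddHaarMeasure] (f : MvPolynomial (Fin (n + 1)) k) :
    ∃ K : ℝ, 0 ≤ K ∧ ∀ (c : k) (A : Set (Fin (n + 1) → k)), MeasurableSet A → ∀ δ r : ℝ, 0 < δ →
      0 < r → (∀ x ∈ A, x ∈ levelSet f c → δ ≤ ‖polyGrad f x‖ ∧ ‖x‖ ≤ r) →
      canonicalMeasure ν f c A ≤ ENNReal.ofReal (K * δ⁻¹ * r ^ n) := by
  obtain ⟨K, hK, hKr⟩ := hν.exists_measure_pi_closedBall_le n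
  refine ⟨(n + 1) * f.totalDegree * K, by positivity, fun c A hA δ r hδ hr h => ?_⟩
  refine (canonicalMeasure_le ν f c hA hδ h).trans ?_
  refine (mul_le_mul_right (hKr r hr) _).trans (le_of_eq ?_)
  rw [← ENNReal.ofReal_mul (by positivity)]
  congr 1
  ring

end Upper

/-! ### Infinite mass near the singular point -/

section Lower

variable {k : Type*} [NontriviallyNormedField k] {n : ℕ}

theorem smul_mem_levelPiece {m d : ℕ} {f : MvPolynomial (Fin m) k} (hf : f.IsHomogeneous d)
    {i : Fin m} {x : Fin m → k} (hx : x ∈ levelPiece f 0 i) {b : k} (hb : b ≠ 0) :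
    b • x ∈ levelPiece f 0 i := by
  have hbp : 0 < ‖b ^ (d - 1)‖ := norm_pos_iff.2 (pow_ne_zero _ hb)
  have hg : ∀ j, polyGrad f (b • x) j = b ^ (d - 1) * polyGrad f x j := fun j => by
    rw [polyGrad_smul hf, Pi.smul_apply, smul_eq_mul]
  refine ⟨⟨?_, ?_⟩, fun j => ?_, fun j hj => ?_⟩
  · have h0 : MvPolynomial.eval x f = 0 := hx.1.1
    rw [levelSet, mem_ofPred_eq, hf.eval_smul_eq, h0, mul_zero]
  · rw [hg]
    exact mul_ne_zero (pow_ne_zero _ hb) hx.1.2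
  · rw [hg, hg, norm_mul, norm_mul]
    exact mul_le_mul_of_nonneg_left (hx.2.1 j) hbp.le
  · rw [hg, hg, norm_mul, norm_mul]
    exact mul_lt_mul_of_pos_left (hx.2.2 j hj) hbp

/-- The projection `π_i` is open at the points of `L_{c,i}`. -/
theorem exists_closedBall_subset_removeNth_image [CompleteSpace k]
    (f : MvPolynomial (Fin (n + 1)) k) (c : k) (i : Fin (n + 1)) {p : Fin (n + 1) → k}
    (hp : p ∈ levelChart f c i) {V : Set (Fin (n + 1) → k)} (hV : V ∈ 𝓝 p) :
    ∃ r : ℝ, 0 < r ∧ ∀ y ∈ Metric.closedBall (i.removeNth p) r,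
      ∃ t : k, i.insertNth (α := fun _ => k) t y ∈ V ∩ levelSet f c := by
  -- `G` straightens the level sets. Since `∂f/∂x_i (p) ≠ 0`, its derivative at `p` is surjective,
  -- so images of neighbourhoods of `p` are neighbourhoods of `G p`; the slice with second
  -- coordinate `c` gives the claim.
  set G : (Fin (n + 1) → k) → (Fin n → k) × k := fun z => (i.removeNth z, MvPolynomial.eval z f)
    with hG
  set P : (Fin (n + 1) → k) →L[k] (Fin n → k) :=
    ContinuousLinearMap.pi fun j => ContinuousLinearMap.proj (i.succAbove j) with hP
  have hder : HasStrictFDerivAt G (P.prod (∑ j, polyGrad f p j •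
      ContinuousLinearMap.proj (R := k) (φ := fun _ : Fin (n + 1) => k) j)) p :=
    (P.hasStrictFDerivAt (x := p)).prodMk (hasStrictFDerivAt_eval f p)
  have hsurj : (P.prod (∑ j, polyGrad f p j •
      ContinuousLinearMap.proj (R := k) (φ := fun _ : Fin (n + 1) => k) j)).range = ⊤ := by
    rw [LinearMap.range_eq_top]
    rintro ⟨v, s⟩
    refine ⟨i.insertNth (α := fun _ => k)
      ((s - ∑ j, polyGrad f p (i.succAbove j) * v j) / polyGrad f p i) v, ?_⟩
    refine Prod.ext ?_ ?_
    · funext j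
      simp [hP]
    · have := hp.2
      simp only [ContinuousLinearMap.coe_coe, ContinuousLinearMap.prod_apply, sum_apply,
        smul_apply, ContinuousLinearMap.proj_apply, smul_eq_mul]
      rw [Fin.sum_univ_succAbove _ i]
      simp only [Fin.insertNth_apply_same, Fin.insertNth_apply_succAbove]
      field_simp
      ring
  have himg : G '' V ∈ 𝓝 (i.removeNth p, c) := by
    have h1 := Filter.image_mem_map (m := G) hV
    rw [hder.map_nhds_eq_of_surj hsurj] at h1
    have h2 : G p = (i.removeNth p, c) := Prod.ext rfl hp.1
    rwa [h2] at h1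
  have hcont : Continuous fun y : Fin n → k => (y, c) := by fun_prop
  obtain ⟨r, hr, hball⟩ := Metric.nhds_basis_closedBall.mem_iff.1
    (hcont.continuousAt.preimage_mem_nhds (x := i.removeNth p) himg)
  refine ⟨r, hr, fun y hy => ?_⟩
  obtain ⟨z, hz, hzy⟩ := hball hy
  have h1 : i.removeNth z = y := congrArg Prod.fst hzy
  have h2 : MvPolynomial.eval z f = c := congrArg Prod.snd hzy
  refine ⟨z i, ?_⟩
  rw [← h1, Fin.insertNth_self_removeNth]
  exact ⟨hz, h2⟩

variable [LocallyCompactSpace k] [MeasurableSpace k] [BorelSpace k]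

/-- A single point in the fibre over `y` already contributes at least `M⁻¹` to the fibre sum. -/
theorem le_canonicalMeasure (ν : Measure k) (f : MvPolynomial (Fin (n + 1)) k) (c : k)
    (i : Fin (n + 1)) {A : Set (Fin (n + 1) → k)} (hA : MeasurableSet A) {Y : Set (Fin n → k)}
    (hY : MeasurableSet Y) {M : ℝ}
    (h : ∀ y ∈ Y, ∃ t : k, i.insertNth (α := fun _ => k) t y ∈ A ∩ levelPiece f c i ∧
      ‖polyGrad f (i.insertNth (α := fun _ => k) t y) i‖ ≤ M) :
    (ENNReal.ofReal M)⁻¹ * (Measure.pi fun _ : Fin n => ν) Y ≤ canonicalMeasure ν f c A := by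
  rw [canonicalMeasure_apply ν f c hA]
  refine le_trans ?_ (Finset.single_le_sum (f := fun i =>
    ∫⁻ y, fibreSum f c i (A ∩ levelPiece f c i) y ∂(Measure.pi fun _ : Fin n => ν))
    (fun _ _ => zero_le) (Finset.mem_univ i))
  rw [← lintegral_indicator_const hY]
  refine lintegral_mono fun y => indicator_apply_le' (fun hy => ?_) fun _ => zero_le
  obtain ⟨t, ht, htM⟩ := h y hy
  refine le_trans ?_ (ENNReal.le_tsum t)
  rw [indicator_of_mem (show _ ∈ _ ∩ levelChart f c i from ⟨ht, ht.2.1⟩), ENNReal.inv_le_inv,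
    ← ofReal_norm]
  exact ENNReal.ofReal_le_ofReal htM

/-- If the degree of `f` exceeds the number of variables and `L_0` has a smooth point, inside one
of the Borel pieces of `L_0`, then the canonical measure of `L_0` is infinite near the origin. -/
theorem IsNormalizedAbs.canonicalMeasure_nhds_zero_eq_top {ν : Measure k}
    (hν : IsNormalizedAbs ν) [ν.IsAddHaarMeasure] {d : ℕ} {f : MvPolynomial (Fin (n + 1)) k}
    (hf : f.IsHomogeneous d) (hd : n + 1 < d) {i : Fin (n + 1)} {p : Fin (n + 1) → k}
    (hp : p ∈ levelSet f 0) {V : Set (Fin (n + 1) → k)} (hV : V ∈ 𝓝 p)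
    (hVp : V ∩ levelSet f 0 ⊆ levelPiece f 0 i) {U : Set (Fin (n + 1) → k)} (hU : U ∈ 𝓝 0) :
    canonicalMeasure ν f 0 U = ∞ := by
  have : ProperSpace k := ProperSpace.of_locallyCompactSpace k
  obtain ⟨s, hs, hsU⟩ := Metric.mem_nhds_iff.1 hU
  set M : ℝ := ‖polyGrad f p i‖ + 1
  have hM : 0 < M := by positivity
  set ρ : ℝ := ‖p‖ + 1
  have hρ : 0 < ρ := by positivity
  -- The patch of the cone to be rescaled: its derivative bound `M` controls the density from below,
  -- and `ρ` decides when the rescaled patch fits inside `U`.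
  have hV' : V ∩ ({z | ‖polyGrad f z i‖ < M} ∩ {z | ‖z‖ < ρ}) ∈ 𝓝 p := by
    refine Filter.inter_mem hV (Filter.inter_mem ?_ ?_)
    · exact (isOpen_lt (continuous_polyGrad_apply f i).norm continuous_const).mem_nhds
        (lt_add_one ‖polyGrad f p i‖)
    · exact (isOpen_lt continuous_norm continuous_const).mem_nhds (lt_add_one ‖p‖)
  obtain ⟨r, hr, hY⟩ := exists_closedBall_subset_removeNth_image f 0 i
    (hVp ⟨mem_of_mem_nhds hV, hp⟩).1 hV'
  set v : ℝ := (ν (Metric.closedBall 0 r)).toReal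
  have hvν : ν (Metric.closedBall 0 r) = ENNReal.ofReal v :=
    (ENNReal.ofReal_toReal (isCompact_closedBall _ _).measure_lt_top.ne).symm
  have hv : 0 < v := ENNReal.toReal_pos (Metric.measure_closedBall_pos ν 0 hr).ne'
    (isCompact_closedBall _ _).measure_lt_top.ne
  have key : ∀ b : k, b ≠ 0 → ‖b‖ ≤ 1 → ‖b‖ * ρ < s →
      ENNReal.ofReal (M⁻¹ * v ^ n * ‖b‖⁻¹) ≤ canonicalMeasure ν f 0 U := by
    intro b hb hb1 hbs
    have hbp : 0 < ‖b‖ := norm_pos_iff.2 hb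
    -- Multiplication by `b` preserves the piece, scales the base ball by `b` and the derivative by
    -- `b ^ (d - 1)`.
    have hlow : (ENNReal.ofReal (‖b‖ ^ (d - 1) * M))⁻¹ * (Measure.pi fun _ : Fin n => ν)
        (Metric.closedBall (b • i.removeNth p) (‖b‖ * r))
        ≤ canonicalMeasure ν f 0 (Metric.ball 0 s) := by
      refine le_canonicalMeasure ν f 0 i measurableSet_ball Metric.isClosed_closedBall.measurableSet
        fun y hy => ?_
      have hy' : b⁻¹ • y ∈ Metric.closedBall (i.removeNth p) r := by
        rw [Metric.mem_closedBall, dist_eq_norm] at hy ⊢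
        have h1 : b⁻¹ • y - i.removeNth p = b⁻¹ • (y - b • i.removeNth p) := by
          rw [smul_sub, inv_smul_smul₀ hb]
        rw [h1, norm_smul, norm_inv, inv_mul_le_iff₀ hbp]
        exact hy
      obtain ⟨t, ⟨htV, htM, htρ⟩, ht0⟩ := hY _ hy'
      have hpiece := hVp ⟨htV, ht0⟩
      have heq : i.insertNth (α := fun _ => k) (b * t) y
          = b • i.insertNth (α := fun _ => k) t (b⁻¹ • y) := by
        funext j
        refine Fin.succAboveCases i ?_ (fun l => ?_) j <;> simp [hb]
      refine ⟨b * t, ?_⟩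
      rw [heq]
      refine ⟨⟨?_, smul_mem_levelPiece hf hpiece hb⟩, ?_⟩
      · rw [mem_ball_zero_iff, norm_smul]
        exact (mul_le_mul_of_nonneg_left (le_of_lt htρ) hbp.le).trans_lt hbs
      · rw [polyGrad_smul hf, Pi.smul_apply, norm_smul, norm_pow]
        exact mul_le_mul_of_nonneg_left (le_of_lt htM) (by positivity)
    refine le_trans ?_ (hlow.trans (measure_mono hsU))
    rw [Measure.pi_closedBall _ _ (by positivity)]
    simp only [hν.measure_closedBall_mul _ hb, Finset.prod_const, Finset.card_univ,
      Fintype.card_fin, hvν]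
    rw [← ofReal_norm, ← ENNReal.ofReal_mul hbp.le, ← ENNReal.ofReal_pow (by positivity),
      ← ENNReal.ofReal_inv_of_pos (by positivity), ← ENNReal.ofReal_mul (by positivity)]
    refine ENNReal.ofReal_le_ofReal ?_
    -- Here `n + 1 < d` enters: the base contributes `‖b‖ ^ n`, so at least one factor `‖b‖⁻¹` is
    -- left over.
    have h1 : ‖b‖ ^ (d - 1) ≤ ‖b‖ ^ (n + 1) := pow_le_pow_of_le_one hbp.le hb1 (by omega)
    calc M⁻¹ * v ^ n * ‖b‖⁻¹ = (‖b‖ ^ (n + 1) * M)⁻¹ * (‖b‖ * v) ^ n := by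
          rw [mul_pow, pow_succ]
          field_simp
      _ ≤ _ := by gcongr
  by_contra hne
  set m : ℝ := (canonicalMeasure ν f 0 U).toReal
  have hm : 0 ≤ m := ENNReal.toReal_nonneg
  have hc0 : 0 < M⁻¹ * v ^ n := by positivity
  obtain ⟨b, hb0, hb⟩ := NormedField.exists_norm_lt k
    (lt_min one_pos (lt_min (div_pos hs hρ) (div_pos hc0 (by linarith : 0 < m + 1))))
  have hb1 := hb.trans_le (min_le_left _ _)
  have hb2 := hb.trans_le ((min_le_right _ _).trans (min_le_left _ _))
  have hb3 := hb.trans_le ((min_le_right _ _).trans (min_le_right _ _))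
  have h1 := key b (norm_pos_iff.1 hb0) hb1.le ((lt_div_iff₀ hρ).1 hb2)
  rw [ENNReal.ofReal_le_iff_le_toReal hne, ← div_eq_mul_inv, div_le_iff₀ hb0] at h1
  rw [lt_div_iff₀ (by linarith)] at hb3
  nlinarith

end Lower

/-! ### The form `X ^ 4 + Y ^ 4 - Z ^ 4` -/

section Quartic

variable {k : Type*} [NontriviallyNormedField k]

theorem isHomogeneous_quartic :
    (MvPolynomial.X 0 ^ 4 + MvPolynomial.X 1 ^ 4 - MvPolynomial.X 2 ^ 4 :
      MvPolynomial (Fin 3) k).IsHomogeneous 4 :=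
  ((MvPolynomial.isHomogeneous_X_pow _ _).add (MvPolynomial.isHomogeneous_X_pow _ _)).sub
    (MvPolynomial.isHomogeneous_X_pow _ _)

theorem polyGrad_quartic (x : Fin 3 → k) :
    polyGrad (MvPolynomial.X 0 ^ 4 + MvPolynomial.X 1 ^ 4 - MvPolynomial.X 2 ^ 4) x
      = ![4 * x 0 ^ 3, 4 * x 1 ^ 3, -(4 * x 2 ^ 3)] := by
  funext i
  fin_cases i <;>
    simp [polyGrad, MvPolynomial.pderiv_X]

theorem eq_zero_of_polyGrad_quartic_eq_zero [CharZero k] (x : Fin 3 → k)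
    (h : polyGrad (MvPolynomial.X 0 ^ 4 + MvPolynomial.X 1 ^ 4 - MvPolynomial.X 2 ^ 4) x = 0) :
    x = 0 := by
  rw [polyGrad_quartic] at h
  funext i
  have hi := congrFun h i
  fin_cases i <;> simpa using hi

variable [CharZero k] [LocallyCompactSpace k] [MeasurableSpace k] [BorelSpace k]

/-- The first and third partial derivatives tie in size at the smooth point `(1, 0, 1)`, so the
piece containing it need not be a neighbourhood within `L_0`. Either the first index wins throughout
a neighbourhood (as over a non-archimedean `k`), or a nearby point has `|x| < |z|` strictly (as over
`ℝ`), and this open condition puts a neighbourhood in the third piece. -/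
theorem IsNormalizedAbs.canonicalMeasure_quartic_eq_top {ν : Measure k} (hν : IsNormalizedAbs ν)
    [ν.IsAddHaarMeasure] {U : Set (Fin 3 → k)} (hU : U ∈ 𝓝 0) :
    canonicalMeasure ν
      (MvPolynomial.X 0 ^ 4 + MvPolynomial.X 1 ^ 4 - MvPolynomial.X 2 ^ 4) 0 U = ∞ := by
  set F : MvPolynomial (Fin 3) k :=
    MvPolynomial.X 0 ^ 4 + MvPolynomial.X 1 ^ 4 - MvPolynomial.X 2 ^ 4 with hF
  have h4 : 0 < ‖(4 : k)‖ := norm_pos_iff.2 (by norm_num)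
  have hg0 : ∀ x, ‖polyGrad F x 0‖ = ‖(4 : k)‖ * ‖x 0‖ ^ 3 := fun x => by
    rw [hF, polyGrad_quartic]; simp
  have hg1 : ∀ x, ‖polyGrad F x 1‖ = ‖(4 : k)‖ * ‖x 1‖ ^ 3 := fun x => by
    rw [hF, polyGrad_quartic]; simp
  have hg2 : ∀ x, ‖polyGrad F x 2‖ = ‖(4 : k)‖ * ‖x 2‖ ^ 3 := fun x => by
    rw [hF, polyGrad_quartic]; simp
  have hlt : ∀ {a b : k}, ‖a‖ < ‖b‖ → ‖(4 : k)‖ * ‖a‖ ^ 3 < ‖(4 : k)‖ * ‖b‖ ^ 3 := by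
    intro a b hab
    gcongr
  have hle : ∀ {a b : k}, ‖a‖ ≤ ‖b‖ → ‖(4 : k)‖ * ‖a‖ ^ 3 ≤ ‖(4 : k)‖ * ‖b‖ ^ 3 := by
    intro a b hab
    gcongr
  have hne : ∀ {a b : k}, ‖a‖ < ‖b‖ → 0 < ‖(4 : k)‖ * ‖b‖ ^ 3 := by
    intro a b hab
    have := (norm_nonneg a).trans_lt hab
    positivity
  have hopen : ∀ i j : Fin 3, IsOpen {x : Fin 3 → k | ‖x i‖ < ‖x j‖} := fun i j =>
    isOpen_lt (continuous_apply i).norm (continuous_apply j).norm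
  set p : Fin 3 → k := ![1, 0, 1]
  have hp : p ∈ levelSet F 0 := by simp [levelSet, hF, p]
  by_cases hcase : ∃ V ∈ 𝓝 p, ∀ x ∈ V ∩ levelSet F 0, ‖x 2‖ ≤ ‖x 0‖
  · obtain ⟨V, hV, hVx⟩ := hcase
    refine hν.canonicalMeasure_nhds_zero_eq_top isHomogeneous_quartic (by norm_num) (i := 0) hp
      (Filter.inter_mem hV ((hopen 1 0).mem_nhds (by simp [p]))) ?_ hU
    rintro x ⟨⟨hxV, hx10⟩, hx0⟩
    have hx10 : ‖x 1‖ < ‖x 0‖ := hx10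
    have hx20 := hVx x ⟨hxV, hx0⟩
    refine ⟨⟨hx0, norm_pos_iff.1 ?_⟩, fun j => ?_, fun j hj => absurd hj (Fin.not_lt_zero j)⟩
    · rw [hg0]
      exact hne hx10
    · fin_cases j
      · exact le_rfl
      · exact (hg1 x).le.trans ((hle hx10.le).trans (hg0 x).ge)
      · exact (hg2 x).le.trans ((hle hx20).trans (hg0 x).ge)
  · push Not at hcase
    obtain ⟨q, ⟨hq12, hq0⟩, hq02⟩ := hcase _ ((hopen 1 2).mem_nhds (by simp [p]))
    refine hν.canonicalMeasure_nhds_zero_eq_top isHomogeneous_quartic (by norm_num) (i := 2) hq0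
      (((hopen 1 2).inter (hopen 0 2)).mem_nhds ⟨hq12, hq02⟩) ?_ hU
    rintro x ⟨⟨hx12, hx02⟩, hx0⟩
    have h0 : ‖polyGrad F x 0‖ < ‖polyGrad F x 2‖ := by rw [hg0, hg2]; exact hlt hx02
    have h1 : ‖polyGrad F x 1‖ < ‖polyGrad F x 2‖ := by rw [hg1, hg2]; exact hlt hx12
    refine ⟨⟨hx0, norm_pos_iff.1 ((norm_nonneg _).trans_lt h0)⟩, fun j => ?_, fun j hj => ?_⟩
    · fin_cases j
      · exact h0.le
      · exact h1.le
      · exact le_rfl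
    · fin_cases j
      · exact h0
      · exact h1
      · exact absurd hj (lt_irrefl _)

end Quartic

/-! ### The cone `L_0` near the origin -/

section Cone

variable {k : Type*} [NontriviallyNormedField k] [LocallyCompactSpace k] [MeasurableSpace k]
  [BorelSpace k] {n d : ℕ}

theorem canonicalMeasure_singleton_zero (ν : Measure k) {f : MvPolynomial (Fin (n + 1)) k}
    (hd : 2 ≤ d) (hf : f.IsHomogeneous d) : canonicalMeasure ν f 0 {0} = 0 := by
  have : ProperSpace k := ProperSpace.of_locallyCompactSpace k
  refine canonicalMeasure_eq_zero ν f 0 (measurableSet_singleton 0) fun x hx _ => ?_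
  rw [mem_singleton_iff.1 hx]
  exact polyGrad_zero_of_isHomogeneous hf hd

/-- If there are more variables than the degree of `f`, then the canonical measure of `L_0` is
finite near the origin. -/
theorem IsNormalizedAbs.canonicalMeasure_closedBall_lt_top {ν : Measure k}
    (hν : IsNormalizedAbs ν) [ν.IsAddHaarMeasure] {f : MvPolynomial (Fin (n + 1)) k}
    (hd : 2 ≤ d) (hf : f.IsHomogeneous d)
    (hs : ∀ x ∈ levelSet f 0, polyGrad f x = 0 → x = 0) (hdn : d < n + 1) :
    canonicalMeasure ν f 0 (Metric.closedBall 0 1) < ∞ := by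
  have : ProperSpace k := ProperSpace.of_locallyCompactSpace k
  obtain ⟨ε, hε, hgrad⟩ := exists_mul_norm_pow_le_norm_polyGrad hd hf hs
  obtain ⟨K, hK, hμ⟩ := hν.exists_canonicalMeasure_le f
  set θ : ℝ := 1 / 2
  set S : ℕ → Set (Fin (n + 1) → k) := fun j => {x | θ ^ (j + 1) < ‖x‖ ∧ ‖x‖ ≤ θ ^ j}
  have hSm : ∀ j, MeasurableSet (S j) := fun j =>
    (measurableSet_lt measurable_const continuous_norm.measurable).inter
      (measurableSet_le continuous_norm.measurable measurable_const)
  have hθ0 : 0 < θ := by norm_num [θ]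
  have hθ1 : θ < 1 := by norm_num [θ]
  have hcov : Metric.closedBall (0 : Fin (n + 1) → k) 1 ⊆ {0} ∪ ⋃ j, S j := by
    intro x hx
    rw [mem_closedBall_zero_iff] at hx
    rcases eq_or_ne x 0 with rfl | hx0
    · exact Or.inl rfl
    · obtain ⟨j, hj1, hj2⟩ := exists_nat_pow_near_of_lt_one (norm_pos_iff.2 hx0) hx hθ0 hθ1
      exact Or.inr (mem_iUnion.2 ⟨j, hj1, hj2⟩)
  -- On the shell `‖∇f‖ ≥ ε (θ ^ (j + 1)) ^ (d - 1)`, and the base ball contributes `(θ ^ j) ^ n`.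
  -- Since `n ≥ d`, one factor `θ ^ j` survives and gives a geometric series.
  have hshell : ∀ j, canonicalMeasure ν f 0 (S j)
      ≤ ENNReal.ofReal (K * (ε * θ ^ (d - 1))⁻¹ * θ ^ j) := by
    intro j
    refine (hμ 0 (S j) (hSm j) (ε * (θ ^ (j + 1)) ^ (d - 1)) (θ ^ j) (by positivity)
      (by positivity) fun x hx hx0 => ⟨?_, hx.2⟩).trans (ENNReal.ofReal_le_ofReal ?_)
    · refine le_trans ?_ (hgrad x hx0)
      have := hx.1.le
      gcongr
    · have h1 : (θ ^ (j + 1)) ^ (d - 1) = θ ^ (d - 1) * (θ ^ j) ^ (d - 1) := by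
        rw [pow_succ, mul_pow, mul_comm]
      have h2 : (θ ^ j) ^ n ≤ (θ ^ j) ^ (d - 1 + 1) :=
        pow_le_pow_of_le_one (by positivity) (pow_le_one₀ hθ0.le hθ1.le) (by omega)
      rw [h1]
      calc K * (ε * (θ ^ (d - 1) * (θ ^ j) ^ (d - 1)))⁻¹ * (θ ^ j) ^ n
          ≤ K * (ε * (θ ^ (d - 1) * (θ ^ j) ^ (d - 1)))⁻¹ * (θ ^ j) ^ (d - 1 + 1) := by gcongr
        _ = _ := by
          rw [pow_succ (θ ^ j)]
          field_simp
  refine (measure_mono hcov).trans_lt ((measure_union_le _ _).trans_lt ?_)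
  rw [canonicalMeasure_singleton_zero ν hd hf, zero_add]
  refine ((measure_iUnion_le S).trans (ENNReal.tsum_le_tsum hshell)).trans_lt ?_
  exact ((summable_geometric_of_lt_one hθ0.le hθ1).mul_left _).tsum_ofReal_lt_top

theorem IsNormalizedAbs.exists_canonicalMeasure_ball_le [CharZero k] {ν : Measure k}
    (hν : IsNormalizedAbs ν) [ν.IsAddHaarMeasure] {f : MvPolynomial (Fin (n + 1)) k}
    (hd : 1 ≤ d) (hf : f.IsHomogeneous d)
    (hs : ∀ x ∈ levelSet f 0, polyGrad f x = 0 → x = 0) {N : Seminorm k (Fin (n + 1) → k)}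
    (hN : ∀ x, N x = 0 → x = 0) {W : Set k} (hW : IsCompact W) (hW0 : 0 ∉ W) :
    ∃ A : ℝ, ∀ c ∈ W, ∀ R : ℝ, 1 ≤ R →
      canonicalMeasure ν f c {x | N x ≤ R} ≤ ENNReal.ofReal (A * R ^ n) := by
  have : ProperSpace k := ProperSpace.of_locallyCompactSpace k
  obtain ⟨δ, hδ, hgrad⟩ := exists_le_norm_polyGrad hd hf hs hW hW0
  obtain ⟨K, hK, hμ⟩ := hν.exists_canonicalMeasure_le f
  obtain ⟨a, ha, haN⟩ := N.exists_mul_norm_pi_le hN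
  refine ⟨K * δ⁻¹ * a⁻¹ ^ n, fun c hc R hR => ?_⟩
  refine (hμ c _ (measurableSet_le N.continuous_pi.measurable measurable_const) δ (a⁻¹ * R) hδ
    (by positivity) fun x hx hxc => ⟨hgrad c hc x hxc, ?_⟩).trans (le_of_eq ?_)
  · rw [le_inv_mul_iff₀ ha]
    exact (haN x).trans hx
  · rw [mul_pow, mul_assoc]
    ring_nf

/-- Away from the origin `‖∇f‖ ≥ ε ‖x‖ ^ (d - 1)` is a uniform lower bound on `L_0`. The inner
radius `s` is left free so that the annulus can later be fitted to the max-norm unit ball. -/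
theorem IsNormalizedAbs.exists_canonicalMeasure_annulus_le {ν : Measure k}
    (hν : IsNormalizedAbs ν) [ν.IsAddHaarMeasure] {f : MvPolynomial (Fin (n + 1)) k}
    (hd : 2 ≤ d) (hf : f.IsHomogeneous d)
    (hs : ∀ x ∈ levelSet f 0, polyGrad f x = 0 → x = 0) {N : Seminorm k (Fin (n + 1) → k)}
    (hN : ∀ x, N x = 0 → x = 0) {s : ℝ} (hs0 : 0 < s) :
    ∃ A : ℝ, 0 ≤ A ∧ ∀ R : ℝ, 1 ≤ R →
      canonicalMeasure ν f 0 {x | s < N x ∧ N x ≤ R} ≤ ENNReal.ofReal (A * R ^ n) := by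
  have : ProperSpace k := ProperSpace.of_locallyCompactSpace k
  obtain ⟨ε, hε, hgrad⟩ := exists_mul_norm_pow_le_norm_polyGrad hd hf hs
  obtain ⟨K, hK, hμ⟩ := hν.exists_canonicalMeasure_le f
  obtain ⟨a, ha, haN⟩ := N.exists_mul_norm_pi_le hN
  obtain ⟨C, hC, hNC⟩ := N.exists_le_mul_norm_pi
  refine ⟨K * (ε * (C⁻¹ * s) ^ (d - 1))⁻¹ * a⁻¹ ^ n, by positivity, fun R hR => ?_⟩
  refine (hμ 0 _ ((measurableSet_lt measurable_const N.continuous_pi.measurable).inter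
    (measurableSet_le N.continuous_pi.measurable measurable_const)) (ε * (C⁻¹ * s) ^ (d - 1)) (a⁻¹ * R)
    (by positivity) (by positivity) fun x hx hxc => ⟨?_, ?_⟩).trans (le_of_eq ?_)
  · refine le_trans ?_ (hgrad x hxc)
    have : C⁻¹ * s ≤ ‖x‖ := by
      rw [inv_mul_le_iff₀ hC]
      exact hx.1.le.trans (hNC x)
    gcongr
  · rw [le_inv_mul_iff₀ ha]
    exact (haN x).trans hx.2
  · rw [mul_pow, mul_assoc]
    ring_nf

theorem IsNormalizedAbs.exists_canonicalMeasure_zero_ball_le {ν : Measure k}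
    (hν : IsNormalizedAbs ν) [ν.IsAddHaarMeasure] {f : MvPolynomial (Fin (n + 1)) k}
    (hd : 2 ≤ d) (hf : f.IsHomogeneous d)
    (hs : ∀ x ∈ levelSet f 0, polyGrad f x = 0 → x = 0) (hdn : d < n + 1)
    {N : Seminorm k (Fin (n + 1) → k)} (hN : ∀ x, N x = 0 → x = 0) :
    ∃ A : ℝ, ∀ R : ℝ, 1 ≤ R →
      canonicalMeasure ν f 0 {x | N x ≤ R} ≤ ENNReal.ofReal (A * R ^ n) := by
  have : ProperSpace k := ProperSpace.of_locallyCompactSpace k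
  obtain ⟨a, ha, haN⟩ := N.exists_mul_norm_pi_le hN
  -- Inner radius `a`, because `N x ≤ a` forces `‖x‖ ≤ 1`, where the finiteness near the origin
  -- takes over.
  obtain ⟨A, hA, hAR⟩ := hν.exists_canonicalMeasure_annulus_le hd hf hs hN ha
  have hfin := hν.canonicalMeasure_closedBall_lt_top hd hf hs hdn
  set B : ℝ := (canonicalMeasure ν f 0 (Metric.closedBall 0 1)).toReal
  have hB : 0 ≤ B := ENNReal.toReal_nonneg
  refine ⟨B + A, fun R hR => ?_⟩
  have hcov : {x | N x ≤ R} ⊆ Metric.closedBall 0 1 ∪ {x | a < N x ∧ N x ≤ R} := by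
    intro x hx
    rcases le_or_gt (N x) a with h | h
    · left
      rw [mem_closedBall_zero_iff]
      have := (haN x).trans h
      exact le_of_mul_le_mul_left (by simpa using this) ha
    · exact Or.inr ⟨h, hx⟩
  refine (measure_mono hcov).trans ((measure_union_le _ _).trans
    ((add_le_add_right (hAR R hR) _).trans ?_))
  rw [← ENNReal.ofReal_toReal hfin.ne, ← ENNReal.ofReal_add hB (by positivity)]
  refine ENNReal.ofReal_le_ofReal ?_
  have : 1 ≤ R ^ n := one_le_pow₀ hR
  nlinarith

theorem IsNormalizedAbs.isLocallyFiniteMeasure_canonicalMeasure {ν : Measure k}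
    (hν : IsNormalizedAbs ν) [ν.IsAddHaarMeasure] {f : MvPolynomial (Fin (n + 1)) k}
    (hd : 2 ≤ d) (hf : f.IsHomogeneous d)
    (hs : ∀ x ∈ levelSet f 0, polyGrad f x = 0 → x = 0) (hdn : d < n + 1) :
    IsLocallyFiniteMeasure (canonicalMeasure ν f 0) := by
  obtain ⟨A, hA⟩ := hν.exists_canonicalMeasure_zero_ball_le hd hf hs hdn
    (N := normSeminorm k (Fin (n + 1) → k)) fun x hx => norm_eq_zero.1 hx
  refine ⟨fun x => ⟨Metric.closedBall 0 (‖x‖ + 1), ?_, ?_⟩⟩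
  · refine Filter.mem_of_superset (Metric.isOpen_ball.mem_nhds ?_) Metric.ball_subset_closedBall
    simp
  · have h := hA (‖x‖ + 1) (by linarith [norm_nonneg x])
    refine lt_of_le_of_lt (measure_mono fun z hz => ?_) (h.trans_lt ENNReal.ofReal_lt_top)
    simpa using hz

end Cone

/-! ### The proposition -/

theorem proposition7p1 {k : Type*} [NontriviallyNormedField k] [LocallyCompactSpace k] [CharZero k]
    [MeasurableSpace k] [BorelSpace k] (ν : Measure k) [ν.IsAddHaarMeasure]
    (hν : IsNormalizedAbs ν) :
    (∀ (n d : ℕ) (f : MvPolynomial (Fin (n + 1)) k), 2 ≤ d → f.IsHomogeneous d →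
      (∀ x ∈ levelSet f 0, polyGrad f x = 0 → x = 0) →
      ∀ N : Seminorm k (Fin (n + 1) → k), (∀ x, N x = 0 → x = 0) →
        -- lower bound for the gradient
        (∀ W : Set k, IsCompact W → 0 ∉ W →
          ∃ δ : ℝ, 0 < δ ∧ ∀ c ∈ W, ∀ x ∈ levelSet f c, 1 ≤ N x → δ ≤ ‖polyGrad f x‖) ∧
        -- growth of the measures, locally uniform in `c ≠ 0`
        (∀ W : Set k, IsCompact W → 0 ∉ W → ∃ A : ℝ, ∀ c ∈ W, ∀ R : ℝ, 1 ≤ R →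
          canonicalMeasure ν f c {x | N x ≤ R} ≤ ENNReal.ofReal (A * R ^ n)) ∧
        -- growth for `c = 0`, away from the singular point
        (∃ A : ℝ, ∀ R : ℝ, 1 ≤ R →
          canonicalMeasure ν f 0 {x | 1 < N x ∧ N x ≤ R} ≤ ENNReal.ofReal (A * R ^ n)) ∧
        -- finiteness near the singular point, extension to `L_0`, and growth of the extension
        (d < n + 1 →
          (∃ U ∈ 𝓝 (0 : Fin (n + 1) → k), canonicalMeasure ν f 0 U < ∞) ∧
          ∃ μ' : Measure (Fin (n + 1) → k), IsLocallyFiniteMeasure μ' ∧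
            μ' (levelSet f 0)ᶜ = 0 ∧ μ'.restrict {0}ᶜ = canonicalMeasure ν f 0 ∧
            ∃ A : ℝ, ∀ R : ℝ, 1 ≤ R → μ' {x | N x ≤ R} ≤ ENNReal.ofReal (A * R ^ n))) ∧
    -- an example with `m = 3` and `d = 4`
    (∀ F : MvPolynomial (Fin 3) k,
      F = MvPolynomial.X 0 ^ 4 + MvPolynomial.X 1 ^ 4 - MvPolynomial.X 2 ^ 4 →
      F.IsHomogeneous 4 ∧ (∀ x ∈ levelSet F 0, polyGrad F x = 0 → x = 0) ∧
        ∀ U ∈ 𝓝 (0 : Fin 3 → k), canonicalMeasure ν F 0 U = ∞) := by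

  have : ProperSpace k := ProperSpace.of_locallyCompactSpace k
  refine ⟨fun n d f hd hf hs N hN => ⟨fun W hW hW0 => ?_, fun W hW hW0 =>
    hν.exists_canonicalMeasure_ball_le (by omega) hf hs hN hW hW0, ?_, fun hdn => ⟨?_, ?_⟩⟩, ?_⟩
  · obtain ⟨δ, hδ, h⟩ := exists_le_norm_polyGrad (by omega) hf hs hW hW0
    exact ⟨δ, hδ, fun c hc x hx _ => h c hc x hx⟩
  · obtain ⟨A, -, hA⟩ := hν.exists_canonicalMeasure_annulus_le hd hf hs hN one_pos
    exact ⟨A, hA⟩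
  · exact ⟨Metric.closedBall 0 1, Metric.closedBall_mem_nhds _ one_pos,
      hν.canonicalMeasure_closedBall_lt_top hd hf hs hdn⟩
  · have hmeas : MeasurableSet (levelSet f 0) :=
      measurableSet_eq_fun (MvPolynomial.continuous_eval f).measurable measurable_const
    -- The measure is its own extension: as a measure on `k^m` it gives the origin mass `0`, because
    -- `∇f(0) = 0` for `d ≥ 2`.
    refine ⟨canonicalMeasure ν f 0, hν.isLocallyFiniteMeasure_canonicalMeasure hd hf hs hdn,
      canonicalMeasure_eq_zero ν f 0 hmeas.compl fun x hx hx0 => absurd hx0 hx, ?_,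
      hν.exists_canonicalMeasure_zero_ball_le hd hf hs hdn hN⟩
    refine Measure.restrict_eq_self_of_ae_mem ?_
    exact measure_eq_zero_iff_ae_notMem.1 (canonicalMeasure_singleton_zero ν hd hf)
  · rintro F rfl
    exact ⟨isHomogeneous_quartic, fun x _ => eq_zero_of_polyGrad_quartic_eq_zero x,
      fun U hU => hν.canonicalMeasure_quartic_eq_top hU⟩
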